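/- Let $R$ be a Noetherian ring (all rings are commutative) and let $A \subseteq R$ be a subring which is a Noetherian integral domain with field of fractions $\operatorname{Quot}(A)$. Let $\mathfrak p \subset R$ be a prime ideal with $\mathfrak p \cap A = 0$, and let $k(\mathfrak p) = R_{\mathfrak p}/\mathfrak p R_{\mathfrak p}$; both $R_{\mathfrak p}$ and $k(\mathfrak p)$ are then $\operatorname{Quot}(A)$-algebras. For $R$-modules $M, N$, regard $\operatorname{Hom}_A(M,N)$ as an $(R\otimes_A R)$-module by $((r\otimes s)\delta)(m) = r\,\delta(sm)$, and put $[\delta, r](m) = \delta(rm) - r\delta(m)$. Define $\operatorname{Diff}^{-1}_{R/A}(M,N) = 0$ and, for $n \ge 0$, $\operatorname{Diff}^{n}_{R/A}(M,N) = \{\delta \in \operatorname{Hom}_A(M,N) \mid [\delta,r] \in \operatorname{Diff}^{n-1}_{R/A}(M,N) \text{ for all } r\in R\}$, and $\operatorname{Diff}_{R/A}(M,N) = \bigcup_{n\ge 0}\operatorname{Diff}^n_{R/A}(M,N)$. For a set $\mathcal E$ of such operators let $\operatorname{Sol}(\mathcal E) = \{m \in M \mid \delta(m) = 0 \text{ for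 all } \delta\in\mathcal E\}$. Post-composition makes $\operatorname{Hom}_A(M,N)$ an $R$-module, and an $R_{\mathfrak p}$-module when $N = k(\mathfrak p)$. (i) Suppose that $k(\mathfrak p)\otimes_{\operatorname{Quot}(A)} R_{\mathfrak p}$ is a Noetherian ring. Then for every $\mathfrak p$-primary ideal $I \subset R$ there is an $(R\otimes_A R)$-submodule $\mathcal E \subseteq \operatorname{Diff}_{R/A}(R,k(\mathfrak p))$ such that $I = \operatorname{Sol}(\mathcal E)$ and $\mathcal E$ is a finitely generated $R_{\mathfrak p}$-submodule of $\operatorname{Hom}_A(R,k(\mathfrak p))$. (ii) Suppose that $R$ is essentially of finite type over $A$ (a localization of a finitely generated $A$-algebra) and that $N$ is a nonzero finitely generated torsion-free $R/\mathfrak p$-module. (ii.a) For every $\mathfrak p$-primary ideal $I\subset R$ there is an $(R\otimes_A R)$-submodule $\mathcal E \subseteq \operatorname{Diff}_{R/A}(R,N)$ such that $I = \operatorname{Sol}(\mathcal E)$ and $\mathcal E$ is finitely generated as an $R$-module. (ii.b) If the (not necessarily algebraic) field extension $\operatorname{Quot}(A)\hookrightarrow k(\mathfrak p)$ is separable, i.e.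 $k(\mathfrak p)$ stays reduced after base change to an algebraic closure of $\operatorname{Quot}(A)$, then for every integer $n\ge 0$ and every $\mathfrak p$-primary ideal $I \supseteq \mathfrak p^{n+1}$ there is an $(R\otimes_A R)$-submodule $\mathcal E\subseteq \operatorname{Diff}^n_{R/A}(R,N)$ such that $I = \operatorname{Sol}(\mathcal E)$. Moreover, the separability hypothesis in (ii.b) holds whenever $\operatorname{Quot}(A)$ is perfect. -/

import Mathlib

open scoped TensorProduct nonZeroDivisors

noncomputable section

namespace DiffPrimary

section DifferentialOperators

variable (A : Type*) {R : Type*} [CommRing A] [CommRing R] [Algebra A R]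
variable {M N : Type*} [AddCommGroup M] [AddCommGroup N] [Module R M] [Module R N]
variable [Module A M] [Module A N] [IsScalarTower A R M] [IsScalarTower A R N]

/-- Pre-composition with multiplication by elements of `R`, as an `A`-algebra map from `R` to the
`A`-linear endomorphisms of `Hom_A(M, N)`: `s` sends `δ` to `m ↦ δ (s m)`. -/
def precompAlgHom : R →ₐ[A] Module.End A (M →ₗ[A] N) where
  toFun s := LinearMap.lcomp A N (Algebra.lsmul A A M s)
  map_one' := by ext δ m; simp
  map_mul' s t := by ext δ m; simp [mul_comm s t]
  map_zero' := by ext δ m; simp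
  map_add' s t := by ext δ m; simp
  commutes' a := by ext δ m; simp

/-- The action of `R ⊗[A] R` on `Hom_A(M, N)`: the left factor acts by post-composition, the right
factor by pre-composition. -/
def bimoduleAction : R ⊗[A] R →ₐ[A] Module.End A (M →ₗ[A] N) :=
  Algebra.TensorProduct.lift (Algebra.lsmul A A (M →ₗ[A] N)) (precompAlgHom A)
    (fun r s => by
      ext δ m
      simp [precompAlgHom])

/-- `Hom_A(M, N)` as an `(R ⊗[A] R)`-module. -/
instance bimoduleHom : Module (R ⊗[A] R) (M →ₗ[A] N) :=
  Module.compHom (M →ₗ[A] N) (bimoduleAction A (R := R) (M := M) (N := N)).toRingHom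

/-- `((r ⊗ s) δ)(m) = r δ(s m)`. -/
theorem tmul_smul_apply (r s : R) (δ : M →ₗ[A] N) (m : M) :
    ((r ⊗ₜ[A] s) • δ) m = r • δ (s • m) := by
  change bimoduleAction A (r ⊗ₜ[A] s) δ m = _
  simp [bimoduleAction, precompAlgHom]

variable {A}

/-- The bracket `[δ, r](m) = δ (r m) - r δ(m)`. -/
def bracket (δ : M →ₗ[A] N) (r : R) : M →ₗ[A] N :=
  δ ∘ₗ Algebra.lsmul A A M r - r • δ

theorem bracket_apply (δ : M →ₗ[A] N) (r : R) (m : M) :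
    bracket δ r m = δ (r • m) - r • δ m := rfl

theorem bracket_eq_smul (δ : M →ₗ[A] N) (r : R) :
    bracket δ r = ((1 : R) ⊗ₜ[A] r - r ⊗ₜ[A] (1 : R)) • δ := by
  ext m
  rw [sub_smul, LinearMap.sub_apply, tmul_smul_apply, tmul_smul_apply, bracket_apply]
  simp

variable (A R M N)

/-- The `A`-linear differential operators `M → N` of order less than `n`: for `n = 0` (order at most
`-1`) only the zero map, and `δ` has order less than `n + 1` iff every bracket `[δ, r]` has order
less than `n`. -/
def diffLT : ℕ → Submodule (R ⊗[A] R) (M →ₗ[A] N)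
  | 0 => ⊥
  | n + 1 =>
    { carrier := {δ | ∀ r : R, bracket δ r ∈ diffLT n}
      zero_mem' := fun r => by
        rw [bracket_eq_smul, smul_zero]
        exact zero_mem _
      add_mem' := fun {δ ε} hδ hε r => by
        rw [bracket_eq_smul, smul_add, ← bracket_eq_smul, ← bracket_eq_smul]
        exact add_mem (hδ r) (hε r)
      smul_mem' := fun t δ hδ r => by
        rw [bracket_eq_smul, smul_comm, ← bracket_eq_smul]
        exact Submodule.smul_mem _ t (hδ r) }

/-- `Diff^n_{R/A}(M, N)`, the `A`-linear differential operators of order at most `n`. -/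
def diffOp (n : ℕ) : Submodule (R ⊗[A] R) (M →ₗ[A] N) := diffLT A R M N (n + 1)

variable {A R M N}

theorem mem_diffLT_succ (n : ℕ) (δ : M →ₗ[A] N) :
    δ ∈ diffLT A R M N (n + 1) ↔ ∀ r : R, bracket δ r ∈ diffLT A R M N n := Iff.rfl

variable (A R M N)

theorem diffLT_le_succ (n : ℕ) : diffLT A R M N n ≤ diffLT A R M N (n + 1) := by
  induction n with
  | zero => exact bot_le
  | succ k ih => exact fun δ hδ r => ih (hδ r)

theorem diffOp_mono : Monotone (diffOp A R M N) :=
  monotone_nat_of_le_succ fun n => diffLT_le_succ A R M N (n + 1)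

/-- `Diff_{R/A}(M, N)`, the union of the `Diff^n_{R/A}(M, N)`. -/
def diffOps : Submodule (R ⊗[A] R) (M →ₗ[A] N) where
  carrier := {δ | ∃ n : ℕ, δ ∈ diffOp A R M N n}
  zero_mem' := ⟨0, zero_mem _⟩
  add_mem' := by
    rintro δ ε ⟨m, hm⟩ ⟨n, hn⟩
    exact ⟨max m n, add_mem (diffOp_mono A R M N (le_max_left m n) hm)
      (diffOp_mono A R M N (le_max_right m n) hn)⟩
  smul_mem' := by
    rintro t δ ⟨n, hn⟩
    exact ⟨n, Submodule.smul_mem _ t hn⟩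

variable {A R M N}

/-- `Sol(E)`, the common kernel of the operators in `E`. -/
def sol (E : Set (M →ₗ[A] N)) : Set M := {m | ∀ δ ∈ E, δ m = 0}

/-- A subset `E` of an `S`-module `H` is (the underlying set of) a finitely generated
`S`-submodule. -/
def IsFGSubmodule (S : Type*) {H : Type*} [Semiring S] [AddCommMonoid H] [Module S H]
    (E : Set H) : Prop :=
  ∃ t : Finset H, (Submodule.span S (t : Set H) : Set H) = E

end DifferentialOperators

section ResidueField

variable {A R : Type*} [CommRing A] [IsDomain A] [CommRing R] [Algebra A R]
variable (p : Ideal R) [p.IsPrime]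

/-- The canonical map `Quot(A) → R_p`, for a prime `p` with `p ∩ A = 0`. -/
def quotToLocalization (hp : p.comap (algebraMap A R) = ⊥) :
    FractionRing A →+* Localization.AtPrime p :=
  IsLocalization.lift (M := A⁰) (g := algebraMap A (Localization.AtPrime p)) (fun a => by
    rw [IsScalarTower.algebraMap_apply A R (Localization.AtPrime p)]
    refine IsLocalization.map_units (Localization.AtPrime p)
      (⟨algebraMap A R a, fun h => ?_⟩ : p.primeCompl)
    have h0 : (a : A) ∈ p.comap (algebraMap A R) := h
    rw [hp, Ideal.mem_bot] at h0
    exact nonZeroDivisors.coe_ne_zero a h0)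

/-- `R_p` as a `Quot(A)`-algebra. Through it `k(p) = R_p / p R_p` is a `Quot(A)`-algebra as well. -/
abbrev quotAlgebra (hp : p.comap (algebraMap A R) = ⊥) :
    Algebra (FractionRing A) (Localization.AtPrime p) :=
  (quotToLocalization p hp).toAlgebra

/-- `k(p) ⊗_{Quot(A)} R_p` is a Noetherian ring. -/
def ResidueTensorIsNoetherian (hp : p.comap (algebraMap A R) = ⊥) : Prop :=
  letI := quotAlgebra p hp
  IsNoetherianRing (p.ResidueField ⊗[FractionRing A] Localization.AtPrime p)

/-- `Quot(A) → k(p)` is a separable, not necessarily algebraic, field extension: `k(p)` remains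
reduced after base change to an algebraic closure of `Quot(A)`. -/
def IsSeparableResidueExtension (hp : p.comap (algebraMap A R) = ⊥) : Prop :=
  letI := quotAlgebra p hp
  Algebra.IsGeometricallyReduced (FractionRing A) p.ResidueField

end ResidueField

end DiffPrimary

end

/-!
Write `F = Quot(A)`, `S = R_p`, `K = k(p)`, and, for a primary ideal `I` with radical `p`,
`B = S / I S`, an Artinian local `F`-algebra with residue map `π : B → K`. Let `𝔮` be the kernel of
the multiplication map `K ⊗[F] B → K` (`diagIdeal π`).

A `K`-linear functional `φ` on `K ⊗[F] B` gives the operator `r ↦ φ (1 ⊗ r)` from `R` to `K`, and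
the bracket with `r` replaces `φ` by `φ ∘ (1 ⊗ r - r ⊗ 1)`. As `1 ⊗ r - r ⊗ 1` lies in `𝔮`, a
functional vanishing on `𝔮 ^ n` gives an operator of order less than `n`
(`functionalOp_mem_diffLT`). Functionals separate points of `(K ⊗[F] B) / 𝔮 ^ n`, so these operators
cut out `I` as soon as no nonzero `b` has `1 ⊗ b ∈ 𝔮 ^ n` (`sol_functionalOps`).

If `K ⊗[F] S`, hence `K ⊗[F] B`, is Noetherian, then `(K ⊗[F] B) / 𝔮 ^ n` is finite-dimensional,
which gives finite generation. Krull's intersection theorem together with freeness of `K ⊗[F] B`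
over `B` gives a suitable `n` (`exists_forall_tmul_mem_diagIdeal_pow`).

If `K` is separable and essentially of finite type over `F`, it is separably generated, hence
formally smooth (`formallySmooth_of_isGeometricallyReduced`), so `π` has a section. The resulting
retraction `K ⊗[F] B → B` maps `𝔮` into `ker π`, and every `n` with `p ^ n ≤ I` is suitable
(`eq_zero_of_tmul_mem_diagIdeal_pow`).

If `R` is essentially of finite type over `A`, an operator on `R` is determined by its value at `1`
and its brackets with finitely many generators. By induction on the order, the operators of bounded
order into a Noetherian module form a Noetherian module (`isNoetherian_leftDiffLT`), and each
operator has its values in a finitely generated submodule (`exists_fg_range_le`). Clearing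
denominators then carries operators from `k(p)` to `R / p`, which embeds into `N`
(`exists_mem_diffLT_apply_eq_zero_iff`).
-/

namespace DiffPrimary

/-! ### Operators on algebras essentially of finite type -/

section FiniteGeneration

variable {A R M N : Type*} [CommRing A] [CommRing R] [Algebra A R]
variable [AddCommGroup M] [AddCommGroup N] [Module R M] [Module R N]
variable [Module A M] [Module A N] [IsScalarTower A R M] [IsScalarTower A R N]

theorem bracket_add (δ ε : M →ₗ[A] N) (r : R) :
    bracket (δ + ε) r = bracket δ r + bracket ε r := by
  simp [bracket_eq_smul]

theorem bracket_smul (s : R) (δ : M →ₗ[A] N) (r : R) :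
    bracket (s • δ) r = s • bracket δ r := by
  ext m
  simp [bracket_apply, smul_sub, smul_comm s r]

theorem tmul_one_smul (r : R) (δ : M →ₗ[A] N) : (r ⊗ₜ[A] (1 : R)) • δ = r • δ := by
  ext m
  simp [tmul_smul_apply]

/-- Post-composition with an injective `R`-linear map preserves and reflects the order of a
differential operator. -/
theorem comp_mem_diffLT_iff {N' : Type*} [AddCommGroup N'] [Module R N'] [Module A N']
    [IsScalarTower A R N'] (f : N →ₗ[R] N') (hf : Function.Injective f) (n : ℕ)
    (δ : M →ₗ[A] N) :
    (f.restrictScalars A) ∘ₗ δ ∈ diffLT A R M N' n ↔ δ ∈ diffLT A R M N n := by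
  induction n generalizing δ with
  | zero =>
    constructor
    · intro h
      have h' : (f.restrictScalars A) ∘ₗ δ = 0 := h
      have : δ = 0 := by
        ext m
        exact hf (by simpa using LinearMap.congr_fun h' m)
      exact this
    · intro h
      have h' : δ = 0 := h
      have : (f.restrictScalars A) ∘ₗ δ = 0 := by simp [h']
      exact this
  | succ n ih =>
    rw [mem_diffLT_succ, mem_diffLT_succ]
    refine forall_congr' fun r => ?_
    rw [← ih]
    have : bracket ((f.restrictScalars A) ∘ₗ δ) r = (f.restrictScalars A) ∘ₗ bracket δ r := by
      ext m
      simp [bracket_apply]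
    rw [this]

/-- The elements with which `δ` commutes form a subalgebra of `R`. -/
def commutant (δ : M →ₗ[A] N) : Subalgebra A R where
  carrier := {r | bracket δ r = 0}
  mul_mem' {r s} hr hs := by
    ext m
    have h1 := LinearMap.congr_fun hr (s • m)
    have h2 := LinearMap.congr_fun hs m
    simp only [bracket_apply, LinearMap.zero_apply, sub_eq_zero] at h1 h2 ⊢
    rw [mul_smul, h1, h2, mul_smul]
  add_mem' {r s} hr hs := by
    ext m
    have h1 := LinearMap.congr_fun hr m
    have h2 := LinearMap.congr_fun hs m
    simp only [bracket_apply, LinearMap.zero_apply, sub_eq_zero] at h1 h2 ⊢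
    rw [add_smul, map_add, h1, h2, add_smul]
  algebraMap_mem' a := by
    ext m
    simp [bracket_apply]

theorem mem_commutant {δ : M →ₗ[A] N} {r : R} :
    r ∈ commutant δ ↔ ∀ m, δ (r • m) = r • δ m := by
  change bracket δ r = 0 ↔ _
  simp [LinearMap.ext_iff, bracket_apply, sub_eq_zero]

/-- If `R` is essentially of finite type over `A`, an operator commuting with the chosen generators
of `R` is `R`-linear: commuting with a unit implies commuting with its inverse. -/
theorem map_smul_of_bracket_finset_eq_zero [Algebra.EssFiniteType A R] (δ : M →ₗ[A] N)
    (h : ∀ x ∈ Algebra.EssFiniteType.finset A R, bracket δ x = 0) (r : R) (m : M) :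
    δ (r • m) = r • δ m := by
  have hle : Algebra.EssFiniteType.subalgebra A R ≤ commutant δ :=
    Algebra.adjoin_le fun x hx => h x hx
  obtain ⟨t, ht, hu, hrt⟩ :=
    (Algebra.essFiniteType_cond_iff A R (Algebra.EssFiniteType.finset A R)).mp
      (Algebra.EssFiniteType.isLocalization A R) r
  have ht' := mem_commutant.mp (hle ht)
  have hrt' := mem_commutant.mp (hle hrt)
  rw [← hu.smul_left_cancel, ← ht', smul_smul, smul_smul, mul_comm t r, hrt']

/-- The underlying `R`-module, for post-composition, of the operators of order less than `n`. -/
def leftDiffLT (A R M N : Type*) [CommRing A] [CommRing R] [Algebra A R]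
    [AddCommGroup M] [AddCommGroup N] [Module R M] [Module R N]
    [Module A M] [Module A N] [IsScalarTower A R M] [IsScalarTower A R N] (n : ℕ) :
    Submodule R (M →ₗ[A] N) where
  carrier := diffLT A R M N n
  add_mem' := add_mem
  zero_mem' := zero_mem _
  smul_mem' r δ hδ := by
    rw [← tmul_one_smul]
    exact Submodule.smul_mem _ _ hδ

/-- An operator on `R` is determined by its value at `1` and its brackets with the generators of
`R`, which have smaller order. -/
theorem isNoetherian_leftDiffLT [Algebra.EssFiniteType A R] [IsNoetherian R N] (n : ℕ) :
    IsNoetherian R (leftDiffLT A R R N n) := by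
  induction n with
  | zero =>
    have : Subsingleton (leftDiffLT A R R N 0) :=
      ⟨fun a b => Subtype.ext ((show (a : R →ₗ[A] N) = 0 from a.2).trans
        (show (b : R →ₗ[A] N) = 0 from b.2).symm)⟩
    infer_instance
  | succ n ih =>
    let f : leftDiffLT A R R N (n + 1) →ₗ[R]
        N × (Algebra.EssFiniteType.finset A R → leftDiffLT A R R N n) :=
      { toFun := fun δ => (δ.1 1, fun x => ⟨bracket δ.1 (x : R), δ.2 x⟩)
        map_add' := fun δ ε => by
          ext <;> simp [bracket_add]
        map_smul' := fun r δ => by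
          ext <;> simp [bracket_smul] }
    refine isNoetherian_of_injective f ?_
    rw [injective_iff_map_eq_zero]
    intro δ hδ
    have h1 : δ.1 1 = 0 := congrArg Prod.fst hδ
    have h2 : ∀ x ∈ Algebra.EssFiniteType.finset A R, bracket δ.1 x = 0 := fun x hx =>
      congrArg Subtype.val (congrFun (congrArg Prod.snd hδ) ⟨x, hx⟩)
    ext r
    have := map_smul_of_bracket_finset_eq_zero δ.1 h2 r 1
    simpa [h1] using this

/-- A differential operator on `R` takes values in a finitely generated `R`-submodule: the one
generated by its value at `1` and by the values of its brackets with the generators of `R`. -/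
theorem exists_fg_range_le [Algebra.EssFiniteType A R] (n : ℕ) (δ : R →ₗ[A] N)
    (hδ : δ ∈ diffLT A R R N n) : ∃ L : Submodule R N, L.FG ∧ ∀ r, δ r ∈ L := by
  induction n generalizing δ with
  | zero =>
    have h : δ = 0 := hδ
    exact ⟨⊥, Submodule.fg_bot, fun r => by simp [h]⟩
  | succ n ih =>
    choose L hL hδL using fun x : R => ih (bracket δ x) (hδ x)
    let P : Submodule R N :=
      (⨆ x ∈ Algebra.EssFiniteType.finset A R, L x) ⊔ Submodule.span R {δ 1}
    refine ⟨P, (Submodule.fg_biSup _ _ fun x _ => hL x).sup (Submodule.fg_span_singleton _),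
      fun r => ?_⟩
    -- Modulo `P` the operator commutes with the generators and kills `1`, so it is zero.
    let ε : R →ₗ[A] N ⧸ P := (P.mkQ.restrictScalars A) ∘ₗ δ
    have hε : ∀ x ∈ Algebra.EssFiniteType.finset A R, bracket ε x = 0 := by
      intro x hx
      ext m
      have : bracket ε x m = P.mkQ (bracket δ x m) := by
        simp [ε, bracket_apply]
      rw [this]
      refine (Submodule.Quotient.mk_eq_zero P).mpr (Submodule.mem_sup_left ?_)
      exact Submodule.mem_iSup_of_mem x (Submodule.mem_iSup_of_mem hx (hδL x m))
    have h := map_smul_of_bracket_finset_eq_zero ε hε r 1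
    have h1 : ε 1 = 0 := (Submodule.Quotient.mk_eq_zero P).mpr
      (Submodule.mem_sup_right (Submodule.mem_span_singleton_self _))
    rw [h1, smul_zero, smul_eq_mul, mul_one] at h
    exact (Submodule.Quotient.mk_eq_zero P).mp h

end FiniteGeneration

/-! ### Separable field extensions -/

section Separability

/-- A geometrically reduced extension which is essentially of finite type is separably generated,
hence formally smooth. In characteristic `p`, reducedness of `F^alg ⊗ K` shows that `p`-th powers of
linearly independent elements are linearly independent. -/
theorem formallySmooth_of_isGeometricallyReduced (F K : Type*) [Field F] [Field K] [Algebra F K]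
    [Algebra.EssFiniteType F K] [Algebra.IsGeometricallyReduced F K] :
    Algebra.FormallySmooth F K := by
  obtain _ | ⟨p, hp, hpk⟩ := CharP.exists' F
  · infer_instance
  have : ExpChar F p := .prime hp.out
  let Ω := AlgebraicClosure F
  have : CharP Ω p := charP_of_injective_algebraMap (algebraMap F Ω).injective p
  have : ExpChar Ω p := .prime hp.out
  have hred : IsReduced (Ω ⊗[F] K) := (Algebra.isGeometricallyReduced_field_iff F K).mp ‹_›
  have : CharP (Ω ⊗[F] K) p := charP_of_injective_algebraMap (algebraMap Ω (Ω ⊗[F] K)).injective p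
  have : ExpChar (Ω ⊗[F] K) p := .prime hp.out
  obtain ⟨s, hs, H⟩ :=
    exists_isTranscendenceBasis_and_isSeparable_of_linearIndepOn_pow_of_essFiniteType
      (k := F) (K := K) p hp.out fun s hs => by
    rw [LinearIndepOn, Fintype.linearIndependent_iff]
    intro c hc
    -- With `d i ^ p = c i`, the element `∑ d i ⊗ i` has `p`-th power `1 ⊗ ∑ c i i ^ p = 0`.
    choose d hd using fun i : (s : Set K) =>
      IsAlgClosed.exists_pow_nat_eq (algebraMap F Ω (c i)) hp.out.pos
    have hli : LinearIndependent Ω fun i : (s : Set K) => (1 : Ω) ⊗ₜ[F] (i : K) :=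
      Module.Flat.linearIndependent_one_tmul hs
    have hpow : (∑ i, d i • ((1 : Ω) ⊗ₜ[F] (i : K))) ^ p = 0 := by
      rw [sum_pow_char]
      calc ∑ i, (d i • ((1 : Ω) ⊗ₜ[F] (i : K))) ^ p
          = ∑ i : (s : Set K), (1 : Ω) ⊗ₜ[F] (c i • (i : K) ^ p) := by
            refine Finset.sum_congr rfl fun i _ => ?_
            rw [smul_pow, Algebra.TensorProduct.tmul_pow, one_pow, hd, algebraMap_smul,
              TensorProduct.tmul_smul]
        _ = 0 := by rw [← TensorProduct.tmul_sum, hc, TensorProduct.tmul_zero]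
    intro i
    have hdi := Fintype.linearIndependent_iff.mp hli d (pow_eq_zero_iff hp.out.ne_zero |>.mp hpow) i
    have := hd i
    rw [hdi, zero_pow hp.out.ne_zero] at this
    exact (map_eq_zero _).mp this.symm
  have : Algebra.IsSeparable (IntermediateField.adjoin F (Set.range ((↑) : s → K))) K := by
    convert! H <;> simp
  exact .of_algebraicIndependent_of_isSeparable hs.1

/-- Over a perfect field, finite extensions are étale, so base change along them preserves
reducedness. -/
theorem isGeometricallyReduced_of_perfectField (F K : Type*) [Field F] [Field K] [Algebra F K]
    [PerfectField F] : Algebra.IsGeometricallyReduced F K := by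
  rw [Algebra.isGeometricallyReduced_field_iff]
  have : IsReduced (K ⊗[F] AlgebraicClosure F) := by
    refine IsReduced.tensorProduct_of_flat_of_forall_fg fun B hB => ?_
    have : Algebra.FiniteType F B := ⟨(Subalgebra.fg_top B).mpr hB⟩
    have : Algebra.IsIntegral F B :=
      Algebra.IsIntegral.of_injective B.val Subtype.val_injective
    let : Field B := (isField_of_isIntegral_of_isField' (Field.toIsField F)).toField
    have : Algebra.FormallyEtale F B := Algebra.FormallyEtale.of_isSeparable F B
    exact Algebra.FormallyUnramified.isReduced_of_field K (K ⊗[F] B)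
  exact isReduced_of_injective (Algebra.TensorProduct.comm F (AlgebraicClosure F) K)
    (AlgEquiv.injective _)

end Separability

/-! ### Powers of the diagonal ideal -/

section ResidueTensor

variable {F K B : Type*} [Field F] [Field K] [CommRing B] [Algebra F K] [Algebra F B]

/-- The multiplication map `K ⊗ B → K` attached to `π : B → K`. -/
noncomputable def mulHom (π : B →ₐ[F] K) : K ⊗[F] B →ₐ[K] K :=
  Algebra.TensorProduct.lift (AlgHom.id K K) π fun _ _ => Commute.all _ _

@[simp]
theorem mulHom_tmul (π : B →ₐ[F] K) (k : K) (b : B) : mulHom π (k ⊗ₜ b) = k * π b := by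
  simp [mulHom]

/-- The kernel of the multiplication map `K ⊗ B → K`, the ideal of the diagonal. -/
noncomputable def diagIdeal (π : B →ₐ[F] K) : Ideal (K ⊗[F] B) := RingHom.ker (mulHom π)

theorem mem_diagIdeal (π : B →ₐ[F] K) (t : K ⊗[F] B) : t ∈ diagIdeal π ↔ mulHom π t = 0 := Iff.rfl

/-- The powers of the diagonal ideal have finite codimension over `K`: with `T = K + 𝔮` and `𝔮`
generated by a finite set `G`, a solution `V` for `𝔮 ^ n` yields `K + ∑ g V` for `𝔮 ^ (n + 1)`. -/
theorem exists_fg_sup_diagIdeal_pow (π : B →ₐ[F] K) [IsNoetherianRing (K ⊗[F] B)] (n : ℕ) :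
    ∃ V : Submodule K (K ⊗[F] B), V.FG ∧ V ⊔ (diagIdeal π ^ n).restrictScalars K = ⊤ := by
  induction n with
  | zero => exact ⟨⊥, Submodule.fg_bot, by simp [Ideal.one_eq_top]⟩
  | succ n ih =>
    obtain ⟨V, hV, hVq⟩ := ih
    obtain ⟨G, hG⟩ := IsNoetherian.noetherian (diagIdeal π)
    let W : Submodule K (K ⊗[F] B) :=
      Submodule.span K {1} ⊔ ⨆ g ∈ G, V.map (LinearMap.mulLeft K g)
    refine ⟨W, (Submodule.fg_span_singleton _).sup
      (Submodule.fg_biSup _ _ fun g _ => hV.map _), ?_⟩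
    have hq : ∀ t ∈ diagIdeal π, t ∈ W ⊔ (diagIdeal π ^ (n + 1)).restrictScalars K := by
      intro t ht
      obtain ⟨c, -, rfl⟩ := Submodule.mem_span_finset.mp (hG ▸ ht)
      refine sum_mem fun g hg => ?_
      have hgq : g ∈ diagIdeal π := hG ▸ Submodule.subset_span hg
      obtain ⟨v, hv, w, hw, hvw⟩ :=
        Submodule.mem_sup.mp (hVq ▸ Submodule.mem_top : c g ∈ V ⊔ _)
      rw [← hvw, smul_eq_mul, mul_comm, mul_add]
      refine add_mem (Submodule.mem_sup_left (Submodule.mem_sup_right ?_))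
        (Submodule.mem_sup_right ?_)
      · exact Submodule.mem_iSup_of_mem g (Submodule.mem_iSup_of_mem hg ⟨v, hv, rfl⟩)
      · rw [pow_succ']
        exact Ideal.mul_mem_mul hgq hw
    rw [eq_top_iff]
    intro t _
    have ht : t - mulHom π t • 1 ∈ diagIdeal π := by
      simp [mem_diagIdeal]
    have := add_mem (hq _ ht) (Submodule.mem_sup_left (Submodule.mem_sup_left
      (Submodule.smul_mem _ (mulHom π t) (Submodule.mem_span_singleton_self (1 : K ⊗[F] B))))
      : mulHom π t • (1 : K ⊗[F] B) ∈ W ⊔ (diagIdeal π ^ (n + 1)).restrictScalars K)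
    simpa using this

/-- A nonzero element of an Artinian local ring is annihilated only by nonunits, which are nilpotent
and so die in `K`. As `K ⊗ B` is free over `B`, the annihilator of `1 ⊗ b` lies in the diagonal
ideal. -/
theorem mem_diagIdeal_of_mul_eq_zero [IsLocalRing B] [IsArtinianRing B] (π : B →ₐ[F] K)
    {b : B} (hb : b ≠ 0) (t : K ⊗[F] B) (ht : t * ((1 : K) ⊗ₜ b) = 0) : t ∈ diagIdeal π := by
  let e := Module.Basis.ofVectorSpace F K
  obtain ⟨c, rfl⟩ := TensorProduct.eq_repr_basis_left e t
  have hc : ∀ i, c i * b = 0 := by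
    have h0 : (c.mapRange (· * b) (zero_mul b)).sum (fun i x => e i ⊗ₜ[F] x) = 0 := by
      rw [Finsupp.sum_mapRange_index (by simp), ← ht, Finsupp.sum, Finsupp.sum, Finset.sum_mul]
      simp
    intro i
    simpa using DFunLike.congr_fun (TensorProduct.sum_tmul_basis_left_eq_zero e _ h0) i
  refine sum_mem fun i _ => ?_
  have hnu : ¬ IsUnit (c i) := fun h => hb (h.mul_right_eq_zero.mp (hc i))
  obtain ⟨n, hn⟩ := (isArtinianRing_iff_isNilpotent_maximalIdeal B).mp ‹_›
  have hnil : IsNilpotent (c i) := ⟨n, by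
    have := Ideal.pow_mem_pow ((IsLocalRing.mem_maximalIdeal _).mpr hnu) n
    rwa [hn] at this⟩
  rw [mem_diagIdeal, mulHom_tmul, (hnil.map π).eq_zero, mul_zero]

/-- By Krull's intersection theorem and the preceding lemma the ideals `{b | 1 ⊗ b ∈ 𝔮 ^ n}` meet
in zero, so one of them vanishes. -/
theorem exists_forall_tmul_mem_diagIdeal_pow [IsLocalRing B] [IsArtinianRing B] (π : B →ₐ[F] K)
    [IsNoetherianRing (K ⊗[F] B)] :
    ∃ n, ∀ b : B, (1 : K) ⊗ₜ[F] b ∈ diagIdeal π ^ (n + 1) → b = 0 := by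
  let f : ℕ →o (Ideal B)ᵒᵈ :=
    ⟨fun n => OrderDual.toDual ((diagIdeal π ^ n).comap
      (Algebra.TensorProduct.includeRight : B →ₐ[F] K ⊗[F] B)),
      fun m n h => Ideal.comap_mono (Ideal.pow_le_pow_right h)⟩
  obtain ⟨n, hn⟩ := IsArtinian.monotone_stabilizes f
  refine ⟨n, fun b hb => by_contra fun hb0 => ?_⟩
  have hmem : ∀ m, (1 : K) ⊗ₜ[F] b ∈ diagIdeal π ^ m := by
    intro m
    rcases le_total m (n + 1) with h | h
    · exact Ideal.pow_le_pow_right h hb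
    · have h1 : f (n + 1) = f m := (hn _ n.le_succ).symm.trans (hn _ (n.le_succ.trans h))
      have h2 : b ∈ OrderDual.ofDual (f (n + 1)) := hb
      rw [h1] at h2
      exact h2
  have hinf : (1 : K) ⊗ₜ[F] b ∈
      (⨅ i : ℕ, diagIdeal π ^ i • ⊤ : Submodule (K ⊗[F] B) (K ⊗[F] B)) := by
    simpa [Submodule.mem_iInf] using hmem
  obtain ⟨r, hr⟩ := (Ideal.mem_iInf_smul_pow_eq_bot_iff _ _).mp hinf
  have h1 := mem_diagIdeal_of_mul_eq_zero π hb0 (1 - (r : K ⊗[F] B))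
    (by rw [sub_mul, one_mul, ← smul_eq_mul, hr, sub_self])
  have h2 := add_mem h1 r.2
  rw [sub_add_cancel, mem_diagIdeal, map_one] at h2
  exact one_ne_zero h2

/-- If `K` is formally smooth over `F`, the residue map `π` has a section; the resulting retraction
`K ⊗ B → B` carries the diagonal ideal into `ker π`. -/
theorem eq_zero_of_tmul_mem_diagIdeal_pow [Algebra.FormallySmooth F K] (π : B →ₐ[F] K)
    (hπ : Function.Surjective π) {n : ℕ} (hn : RingHom.ker π ^ n = ⊥) (b : B)
    (hb : (1 : K) ⊗ₜ[F] b ∈ diagIdeal π ^ n) : b = 0 := by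
  have hnil : IsNilpotent (RingHom.ker (π : B →+* K)) := ⟨n, hn⟩
  let σ : K →ₐ[F] B := Algebra.FormallySmooth.liftOfSurjective (AlgHom.id F K) π hπ hnil
  have hσ : ∀ k, π (σ k) = k := fun k =>
    Algebra.FormallySmooth.liftOfSurjective_apply (AlgHom.id F K) π hπ hnil k
  let ρ : K ⊗[F] B →ₐ[F] B :=
    Algebra.TensorProduct.lift σ (AlgHom.id F B) fun _ _ => Commute.all _ _
  have hρ : ∀ t, π (ρ t) = mulHom π t := by
    intro t
    induction t using TensorProduct.induction_on with
    | zero => simp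
    | tmul k b => simp [ρ, hσ]
    | add x y hx hy => rw [map_add, map_add, map_add, hx, hy]
  have hle : (diagIdeal π).map ρ ≤ RingHom.ker π := by
    rw [Ideal.map_le_iff_le_comap]
    intro t ht
    exact (hρ t).trans ht
  have h := Ideal.mem_map_of_mem ρ hb
  rw [Ideal.map_pow] at h
  have h0 := Ideal.pow_right_mono hle n h
  rw [hn] at h0
  simpa [ρ] using h0

end ResidueTensor

/-! ### Operators given by functionals -/

section Functionals

variable {A R F K B : Type*} [CommRing A] [CommRing R] [Algebra A R] [Field F] [Field K]
variable [CommRing B] [Algebra A F] [Algebra F K] [Algebra F B] [Algebra A K] [Algebra A B]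
variable [Algebra R B] [IsScalarTower A F K] [IsScalarTower A F B] [IsScalarTower A R B]

variable (A R) in
/-- The operator `r ↦ φ (1 ⊗ r)` attached to a `K`-linear functional `φ` on `K ⊗ B`. -/
noncomputable def functionalOp : (K ⊗[F] B →ₗ[K] K) →ₗ[K] (R →ₗ[A] K) where
  toFun φ :=
    { toFun := fun r => φ (1 ⊗ₜ algebraMap R B r)
      map_add' := fun r s => by rw [map_add, TensorProduct.tmul_add, map_add]
      map_smul' := fun a r => by
        rw [Algebra.algebraMap_eq_smul_one (A := B), smul_assoc, ← algebraMap_smul F a,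
          ← Algebra.algebraMap_eq_smul_one,
          TensorProduct.tmul_smul, ← algebraMap_smul K (algebraMap A F a) ((1 : K) ⊗ₜ[F] _),
          map_smul, ← IsScalarTower.algebraMap_apply, algebraMap_smul]
        rfl }
  map_add' φ ψ := rfl
  map_smul' k φ := rfl

@[simp]
theorem functionalOp_apply (φ : K ⊗[F] B →ₗ[K] K) (r : R) :
    functionalOp A R φ r = φ (1 ⊗ₜ algebraMap R B r) := rfl

variable [Algebra R K] [IsScalarTower A R K]

/-- The bimodule action on `functionalOp` corresponds to multiplication inside the functional. -/
theorem tmul_smul_functionalOp (r s : R) (φ : K ⊗[F] B →ₗ[K] K) :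
    (r ⊗ₜ[A] s) • functionalOp A R φ =
      functionalOp A R (φ ∘ₗ LinearMap.mulLeft K (algebraMap R K r ⊗ₜ[F] algebraMap R B s)) := by
  ext m
  rw [tmul_smul_apply, functionalOp_apply, functionalOp_apply, ← algebraMap_smul K r, ← map_smul,
    TensorProduct.smul_tmul', LinearMap.comp_apply, LinearMap.mulLeft_apply,
    Algebra.TensorProduct.tmul_mul_tmul, smul_eq_mul, smul_eq_mul, map_mul]

theorem bracket_functionalOp (r : R) (φ : K ⊗[F] B →ₗ[K] K) :
    bracket (functionalOp A R φ) r = functionalOp A R (φ ∘ₗ LinearMap.mulLeft K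
      ((1 : K) ⊗ₜ[F] algebraMap R B r - algebraMap R K r ⊗ₜ[F] (1 : B))) := by
  rw [bracket_eq_smul, sub_smul, tmul_smul_functionalOp, tmul_smul_functionalOp, ← map_sub]
  congr 1
  ext
  simp [sub_mul]

/-- A functional vanishing on the `n`-th power of the diagonal ideal gives an operator of order less
than `n`, since a bracket multiplies the functional's argument by an element of that ideal. -/
theorem functionalOp_mem_diffLT (π : B →ₐ[F] K)
    (hπ : ∀ r, π (algebraMap R B r) = algebraMap R K r) (n : ℕ) (φ : K ⊗[F] B →ₗ[K] K)
    (hφ : ∀ t ∈ diagIdeal π ^ n, φ t = 0) : functionalOp A R φ ∈ diffLT A R R K n := by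
  induction n generalizing φ with
  | zero =>
    have : φ = 0 := LinearMap.ext fun t => hφ t (by simp)
    rw [this, map_zero]
    exact zero_mem _
  | succ n ih =>
    rw [mem_diffLT_succ]
    intro r
    rw [bracket_functionalOp]
    refine ih _ fun t ht => hφ _ ?_
    rw [pow_succ']
    exact Ideal.mul_mem_mul (by simp [mem_diagIdeal, hπ]) ht

/-- The functionals on `K ⊗ B` vanishing on the `n`-th power of the diagonal ideal. -/
noncomputable def functionals (π : B →ₐ[F] K) (n : ℕ) : Submodule K (K ⊗[F] B →ₗ[K] K) where
  carrier := {φ | ∀ t ∈ diagIdeal π ^ n, φ t = 0}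
  add_mem' hφ hψ t ht := by simp [hφ t ht, hψ t ht]
  zero_mem' _ _ := rfl
  smul_mem' k φ hφ t ht := by simp [hφ t ht]

/-- Restriction to a finite-dimensional `V` with `V + 𝔮 ^ n = K ⊗ B` is injective on the functionals that
vanish on `𝔮 ^ n`. -/
theorem finite_functionals (π : B →ₐ[F] K) [IsNoetherianRing (K ⊗[F] B)] (n : ℕ) :
    Module.Finite K (functionals π n) := by
  obtain ⟨V, hV, hVq⟩ := exists_fg_sup_diagIdeal_pow π n
  have : Module.Finite K V := Module.Finite.iff_fg.mpr hV
  refine Module.Finite.of_injective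
    ((LinearMap.lcomp K K V.subtype) ∘ₗ (functionals π n).subtype) ?_
  rw [injective_iff_map_eq_zero]
  intro φ hφ
  refine Subtype.ext (LinearMap.ext fun t => ?_)
  obtain ⟨v, hv, w, hw, rfl⟩ := Submodule.mem_sup.mp (hVq ▸ Submodule.mem_top : t ∈ V ⊔ _)
  have h1 : φ.1 v = 0 := LinearMap.congr_fun hφ ⟨v, hv⟩
  have h2 : φ.1 w = 0 := φ.2 w hw
  rw [map_add, h1, h2]
  simp

variable (A R) in
/-- The bimodule of operators given by functionals vanishing on the `n`-th power of the diagonal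
ideal. -/
noncomputable def functionalOps (π : B →ₐ[F] K) (n : ℕ) :
    Submodule (R ⊗[A] R) (R →ₗ[A] K) where
  carrier := (functionals π n).map (functionalOp A R)
  add_mem' := add_mem
  zero_mem' := zero_mem _
  smul_mem' t δ hδ := by
    induction t using TensorProduct.induction_on with
    | zero => rw [zero_smul]; exact zero_mem _
    | add x y hx hy => rw [add_smul]; exact add_mem hx hy
    | tmul r s =>
      obtain ⟨φ, hφ, rfl⟩ := hδ
      rw [tmul_smul_functionalOp]
      exact ⟨φ ∘ₗ LinearMap.mulLeft K _, fun t ht => hφ _ (Ideal.mul_mem_left _ _ ht), rfl⟩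

theorem functionalOps_le (π : B →ₐ[F] K)
    (hπ : ∀ r, π (algebraMap R B r) = algebraMap R K r) (n : ℕ) :
    functionalOps A R π n ≤ diffLT A R R K n := by
  rintro _ ⟨φ, hφ, rfl⟩
  exact functionalOp_mem_diffLT π hπ n φ hφ

/-- Functionals separate `K ⊗ B` modulo `𝔮 ^ n`; thus, if no nonzero `1 ⊗ b` lies in `𝔮 ^ n`, the
operators have the kernel of `R → B` as their common kernel. -/
theorem sol_functionalOps (π : B →ₐ[F] K) (n : ℕ)
    (hn : ∀ b : B, (1 : K) ⊗ₜ[F] b ∈ diagIdeal π ^ n → b = 0) :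
    sol (functionalOps A R π n : Set (R →ₗ[A] K)) = (RingHom.ker (algebraMap R B) : Set R) := by
  ext r
  constructor
  · intro h
    refine hn _ (by_contra fun hr => ?_)
    obtain ⟨φ, hφr, hφ⟩ := Submodule.exists_le_ker_of_notMem
      (p := (diagIdeal π ^ n).restrictScalars K) hr
    exact hφr (h _ ⟨φ, fun t ht => hφ ht, rfl⟩)
  · rintro (hr : algebraMap R B r = 0) _ ⟨φ, -, rfl⟩
    simp [hr]

/-- Over any ring `S` mapping onto `K`, the operators form a finitely generated module. -/
theorem isFGSubmodule_functionalOps (S : Type*) [CommRing S] [Algebra S K] [Algebra A S]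
    [IsScalarTower A S K]
    (hS : Function.Surjective (algebraMap S K)) (π : B →ₐ[F] K) [IsNoetherianRing (K ⊗[F] B)]
    (n : ℕ) : IsFGSubmodule S (functionalOps A R π n : Set (R →ₗ[A] K)) := by
  have := finite_functionals π n
  obtain ⟨t, ht⟩ := (Module.Finite.iff_fg.mp this).map (functionalOp A R)
  refine ⟨t, ?_⟩
  rw [← Submodule.restrictScalars_span S K hS, ht]
  rfl

end Functionals

/-! ### The quotient `R_p / I R_p` -/

section ResidueHom

variable {R : Type*} [CommRing R] (p : Ideal R) [p.IsPrime]
variable (F : Type*) [Field F] [Algebra F (Localization.AtPrime p)]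

/-- The residue map `R_p / I R_p → k(p)` for an ideal `I ⊆ p`, over a field `F` mapping to `R_p`. -/
noncomputable def residueHom (I : Ideal R) (hI : I ≤ p) :
    (Localization.AtPrime p ⧸ I.map (algebraMap R (Localization.AtPrime p))) →ₐ[F]
      p.ResidueField :=
  Ideal.Quotient.liftₐ _ (IsScalarTower.toAlgHom F (Localization.AtPrime p) p.ResidueField) (by
    have : I.map (algebraMap R (Localization.AtPrime p)) ≤
        IsLocalRing.maximalIdeal (Localization.AtPrime p) := by
      rw [← Localization.AtPrime.map_eq_maximalIdeal]
      exact Ideal.map_mono hI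
    intro x hx
    exact (IsLocalRing.residue_eq_zero_iff x).mpr (this hx))

theorem residueHom_algebraMap (I : Ideal R) (hI : I ≤ p) (r : R) :
    residueHom p F I hI (algebraMap R _ r) = algebraMap R p.ResidueField r := rfl

theorem residueHom_surjective (I : Ideal R) (hI : I ≤ p) :
    Function.Surjective (residueHom p F I hI) := by
  intro k
  obtain ⟨x, rfl⟩ := IsLocalRing.residue_surjective k
  exact ⟨Ideal.Quotient.mk _ x, rfl⟩

theorem ker_residueHom_pow (I : Ideal R) (hI : I ≤ p) (n : ℕ) (hn : p ^ n ≤ I) :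
    RingHom.ker (residueHom p F I hI) ^ n = ⊥ := by
  have hker : RingHom.ker (residueHom p F I hI) ≤
      (p.map (algebraMap R (Localization.AtPrime p))).map (Ideal.Quotient.mk _) := by
    intro b hb
    obtain ⟨x, rfl⟩ := Ideal.Quotient.mk_surjective b
    rw [Localization.AtPrime.map_eq_maximalIdeal]
    exact Ideal.mem_map_of_mem _ ((IsLocalRing.residue_eq_zero_iff x).mp hb)
  rw [eq_bot_iff]
  refine (Ideal.pow_right_mono hker n).trans ?_
  rw [← Ideal.map_pow, ← Ideal.map_pow]
  refine (Ideal.map_mono (Ideal.map_mono hn)).trans ?_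
  rw [Ideal.map_quotient_self]

theorem isLocalRing_localizationQuotient (I : Ideal R) (hI : I ≤ p) :
    IsLocalRing (Localization.AtPrime p ⧸ I.map (algebraMap R (Localization.AtPrime p))) := by
  have hne : I.map (algebraMap R (Localization.AtPrime p)) ≠ ⊤ := by
    refine ne_top_of_le_ne_top (IsLocalRing.maximalIdeal.isMaximal _).ne_top
      (?_ : _ ≤ IsLocalRing.maximalIdeal (Localization.AtPrime p))
    rw [← Localization.AtPrime.map_eq_maximalIdeal]
    exact Ideal.map_mono hI
  have : Nontrivial (Localization.AtPrime p ⧸ I.map (algebraMap R (Localization.AtPrime p))) :=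
    Ideal.Quotient.nontrivial_iff.mpr hne
  exact .of_surjective' (Ideal.Quotient.mk _) Ideal.Quotient.mk_surjective

theorem isArtinianRing_localizationQuotient [IsNoetherianRing R] (I : Ideal R) (hI : I ≤ p) (n : ℕ)
    (hn : p ^ n ≤ I) :
    IsArtinianRing (Localization.AtPrime p ⧸ I.map (algebraMap R (Localization.AtPrime p))) := by
  have := isLocalRing_localizationQuotient p I hI
  have : IsNoetherianRing (Localization.AtPrime p) :=
    IsLocalization.isNoetherianRing p.primeCompl _ ‹_›
  rw [isArtinianRing_iff_isNilpotent_maximalIdeal]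
  refine ⟨n, ?_⟩
  rw [← IsLocalRing.map_maximalIdeal_of_surjective (Ideal.Quotient.mk _)
    Ideal.Quotient.mk_surjective, ← Localization.AtPrime.map_eq_maximalIdeal, ← Ideal.map_pow,
    ← Ideal.map_pow, Ideal.zero_eq_bot, eq_bot_iff]
  refine (Ideal.map_mono (Ideal.map_mono hn)).trans ?_
  rw [Ideal.map_quotient_self]

theorem ker_algebraMap_localizationQuotient (I : Ideal R) (hI : I.IsPrimary) (hIp : I.radical = p) :
    RingHom.ker (algebraMap R
      (Localization.AtPrime p ⧸ I.map (algebraMap R (Localization.AtPrime p)))) = I := by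
  have hdisj : Disjoint (p.primeCompl : Set R) I :=
    Set.disjoint_left.mpr fun x hx hxI => hx (hIp ▸ Ideal.le_radical hxI)
  conv_rhs => rw [← IsLocalization.under_map_of_isPrimary_disjoint p.primeCompl
    (Localization.AtPrime p) hI hdisj]
  ext r
  exact Ideal.Quotient.eq_zero_iff_mem

end ResidueHom

/-! ### Primary ideals and operators with values in the residue field -/

section Residue

variable {A R : Type*} [CommRing A] [CommRing R] [Algebra A R] (p : Ideal R) [p.IsPrime]
variable (F : Type*) [Field F] [Algebra A F] [Algebra F (Localization.AtPrime p)]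
variable [IsScalarTower A F (Localization.AtPrime p)]

/-- Some finitely generated bimodule of differential operators `R → k(p)` has the given primary
ideal as its solution space. -/
theorem exists_sol_eq_of_isNoetherianRing [IsNoetherianRing R]
    [IsNoetherianRing (p.ResidueField ⊗[F] Localization.AtPrime p)] (I : Ideal R)
    (hI : I.IsPrimary) (hIp : I.radical = p) :
    ∃ (n : ℕ) (E : Submodule (R ⊗[A] R) (R →ₗ[A] p.ResidueField)),
      E ≤ diffOp A R R p.ResidueField n ∧
      (I : Set R) = sol (E : Set (R →ₗ[A] p.ResidueField)) ∧
      IsFGSubmodule (Localization.AtPrime p) (E : Set (R →ₗ[A] p.ResidueField)) := by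
  have hle : I ≤ p := hIp ▸ Ideal.le_radical
  obtain ⟨m, hm⟩ := I.exists_radical_pow_le_of_fg (IsNoetherian.noetherian _)
  rw [hIp] at hm
  have := isLocalRing_localizationQuotient p I hle
  have := isArtinianRing_localizationQuotient p I hle m hm
  let π := residueHom p F I hle
  have : IsNoetherianRing (p.ResidueField ⊗[F]
      (Localization.AtPrime p ⧸ I.map (algebraMap R (Localization.AtPrime p)))) :=
    isNoetherianRing_of_surjective _ _
      (Algebra.TensorProduct.map (AlgHom.id F p.ResidueField) (Ideal.Quotient.mkₐ F
        (I.map (algebraMap R (Localization.AtPrime p))))).toRingHom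
      (TensorProduct.map_surjective Function.surjective_id Ideal.Quotient.mk_surjective)
  have : IsScalarTower A F p.ResidueField := .of_algebraMap_eq fun a => by
    rw [IsScalarTower.algebraMap_apply A (Localization.AtPrime p) p.ResidueField,
      IsScalarTower.algebraMap_apply A F (Localization.AtPrime p),
      ← IsScalarTower.algebraMap_apply F (Localization.AtPrime p) p.ResidueField]
  obtain ⟨n, hn⟩ := exists_forall_tmul_mem_diagIdeal_pow π
  refine ⟨n, functionalOps A R π (n + 1),
    functionalOps_le π (residueHom_algebraMap p F I hle) (n + 1), ?_, ?_⟩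
  · rw [sol_functionalOps π _ hn, ker_algebraMap_localizationQuotient p I hI hIp]
  · exact isFGSubmodule_functionalOps _ IsLocalRing.residue_surjective π (n + 1)

/-- If `k(p)` is formally smooth over `F`, operators `R → k(p)` of order less than `n` suffice to
describe a primary ideal containing `p ^ n`. -/
theorem exists_sol_eq_of_formallySmooth [Algebra.FormallySmooth F p.ResidueField] (I : Ideal R)
    (hI : I.IsPrimary) (hIp : I.radical = p) (n : ℕ) (hn : p ^ n ≤ I) :
    ∃ E : Submodule (R ⊗[A] R) (R →ₗ[A] p.ResidueField),
      E ≤ diffLT A R R p.ResidueField n ∧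
      (I : Set R) = sol (E : Set (R →ₗ[A] p.ResidueField)) := by
  have hle : I ≤ p := hIp ▸ Ideal.le_radical
  let π := residueHom p F I hle
  have : IsScalarTower A F p.ResidueField := .of_algebraMap_eq fun a => by
    rw [IsScalarTower.algebraMap_apply A (Localization.AtPrime p) p.ResidueField,
      IsScalarTower.algebraMap_apply A F (Localization.AtPrime p),
      ← IsScalarTower.algebraMap_apply F (Localization.AtPrime p) p.ResidueField]
  refine ⟨functionalOps A R π n, functionalOps_le π (residueHom_algebraMap p F I hle) n, ?_⟩
  rw [sol_functionalOps π _ (eq_zero_of_tmul_mem_diagIdeal_pow π (residueHom_surjective p F I hle)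
      (ker_residueHom_pow p F I hle n hn)),
    ker_algebraMap_localizationQuotient p I hI hIp]

end Residue

/-! ### Operators with values in torsion-free modules -/

section Transfer

variable {A R : Type*} [CommRing A] [CommRing R] [Algebra A R] {p : Ideal R} [p.IsPrime]
variable {N : Type*} [AddCommGroup N] [Nontrivial N] [Module (R ⧸ p) N] [Module R N] [Module A N]
variable [IsScalarTower R (R ⧸ p) N] [IsScalarTower A R N] [Module.IsTorsionFree (R ⧸ p) N]

variable (N) in
/-- Clearing denominators turns an operator with values in `k(p)` into one with values in `R / p`,
which embeds into every nonzero torsion-free `R / p`-module; neither the zeros nor the order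
change. -/
theorem exists_mem_diffLT_apply_eq_zero_iff [Algebra.EssFiniteType A R] (n : ℕ)
    (δ : R →ₗ[A] p.ResidueField) (hδ : δ ∈ diffLT A R R p.ResidueField n) :
    ∃ δ' ∈ diffLT A R R N n, ∀ r, δ' r = 0 ↔ δ r = 0 := by
  obtain ⟨_, ⟨t, rfl⟩, hL⟩ := exists_fg_range_le n δ hδ
  obtain ⟨⟨b, hb⟩, hbt⟩ := IsLocalization.exist_integer_multiples_of_finset (R ⧸ p)⁰ t
  obtain ⟨s, rfl⟩ := Ideal.Quotient.mk_surjective b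
  have hs : algebraMap R p.ResidueField s ≠ 0 := fun h =>
    nonZeroDivisors.ne_zero hb
      (Ideal.Quotient.eq_zero_iff_mem.mpr (Ideal.algebraMap_residueField_eq_zero.mp h))
  let ι : R ⧸ p →ₗ[R] p.ResidueField := (IsScalarTower.toAlgHom R (R ⧸ p) _).toLinearMap
  have hι : Function.Injective ι := Ideal.injective_algebraMap_quotient_residueField p
  have hrange : ∀ r, ∃ y, ι y = s • δ r := by
    intro r
    have hle : Submodule.span R (t : Set p.ResidueField) ≤
        (LinearMap.range ι).comap (LinearMap.lsmul R p.ResidueField s) := by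
      rw [Submodule.span_le]
      intro a ha
      obtain ⟨y, hy⟩ := hbt a ha
      refine ⟨y, hy.trans ?_⟩
      rw [Algebra.smul_def, LinearMap.lsmul_apply, Algebra.smul_def,
        Ideal.algebraMap_quotient_residueField_mk]
    exact hle (hL r)
  choose g hg using hrange
  let δ₁ : R →ₗ[A] R ⧸ p :=
    { toFun := g
      map_add' := fun x y => hι (by simp [hg])
      map_smul' := fun a x => hι (by
        change ι (g (a • x)) = (ι.restrictScalars A) (a • g x)
        rw [map_smul, LinearMap.restrictScalars_apply, hg, hg, map_smul, smul_comm]) }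
  have hδ₁ : δ₁ ∈ diffLT A R R (R ⧸ p) n := by
    rw [← comp_mem_diffLT_iff ι hι]
    have : (ι.restrictScalars A) ∘ₗ δ₁ = (s ⊗ₜ[A] (1 : R)) • δ := by
      ext r
      rw [tmul_one_smul]
      exact hg r
    rw [this]
    exact Submodule.smul_mem _ _ hδ
  obtain ⟨v, hv⟩ := exists_ne (0 : N)
  let j : R ⧸ p →ₗ[R] N := (LinearMap.toSpanSingleton (R ⧸ p) N v).restrictScalars R
  have hj : Function.Injective j := smul_left_injective _ hv
  refine ⟨(j.restrictScalars A) ∘ₗ δ₁, (comp_mem_diffLT_iff j hj n δ₁).mpr hδ₁, fun r => ?_⟩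
  have h1 : j (g r) = 0 ↔ g r = 0 := map_eq_zero_iff j hj
  have h2 : g r = 0 ↔ s • δ r = 0 := by rw [← hg, map_eq_zero_iff ι hι]
  have h3 : s • δ r = 0 ↔ δ r = 0 := by
    rw [Algebra.smul_def, mul_eq_zero, or_iff_right hs]
  exact h1.trans (h2.trans h3)

/-- The operators of order less than `n` that vanish on the ideal `I`. -/
def vanishingOps (A : Type*) {R : Type*} [CommRing A] [CommRing R] [Algebra A R] (N : Type*)
    [AddCommGroup N] [Module R N] [Module A N] [IsScalarTower A R N] (n : ℕ) (I : Ideal R) :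
    Submodule (R ⊗[A] R) (R →ₗ[A] N) where
  carrier := {δ | δ ∈ diffLT A R R N n ∧ ∀ x ∈ I, δ x = 0}
  add_mem' hδ hε := ⟨add_mem hδ.1 hε.1, fun x hx => by simp [hδ.2 x hx, hε.2 x hx]⟩
  zero_mem' := ⟨zero_mem _, fun _ _ => rfl⟩
  smul_mem' t δ hδ := by
    refine ⟨Submodule.smul_mem _ _ hδ.1, ?_⟩
    induction t using TensorProduct.induction_on with
    | zero => simp
    | tmul r s =>
      intro x hx
      rw [tmul_smul_apply, smul_eq_mul, hδ.2 _ (I.mul_mem_left s hx), smul_zero]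
    | add a b ha hb =>
      intro x hx
      rw [add_smul, LinearMap.add_apply, ha x hx, hb x hx, add_zero]

variable (N) in
/-- If some operators `R → k(p)` of order less than `n` cut out `I`, then so do all operators
`R → N` of order less than `n` that vanish on `I`. -/
theorem sol_vanishingOps [Algebra.EssFiniteType A R] (n : ℕ) (I : Ideal R)
    (E : Submodule (R ⊗[A] R) (R →ₗ[A] p.ResidueField)) (hE : E ≤ diffLT A R R p.ResidueField n)
    (hI : (I : Set R) = sol (E : Set (R →ₗ[A] p.ResidueField))) :
    (I : Set R) = sol (vanishingOps A N n I : Set (R →ₗ[A] N)) := by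
  refine Set.Subset.antisymm (fun x hx δ hδ => hδ.2 x hx) fun x hx => ?_
  rw [hI]
  intro δ hδ
  obtain ⟨δ', hδ', h⟩ := exists_mem_diffLT_apply_eq_zero_iff N n δ (hE hδ)
  refine (h x).mp (hx δ' ⟨hδ', fun y hy => (h y).mpr ?_⟩)
  have hy' : y ∈ sol (E : Set (R →ₗ[A] p.ResidueField)) := hI ▸ hy
  exact hy' δ hδ

theorem isFGSubmodule_vanishingOps {A R N : Type*} [CommRing A] [CommRing R] [Algebra A R]
    [AddCommGroup N] [Module R N] [Module A N] [IsScalarTower A R N] [Algebra.EssFiniteType A R]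
    [IsNoetherian R N] (n : ℕ) (I : Ideal R) :
    IsFGSubmodule R (vanishingOps A N n I : Set (R →ₗ[A] N)) := by
  have := isNoetherian_leftDiffLT (A := A) (R := R) (N := N) n
  let V : Submodule R (R →ₗ[A] N) :=
    { carrier := vanishingOps A N n I
      add_mem' := add_mem
      zero_mem' := zero_mem _
      smul_mem' := fun r δ hδ => by
        rw [← tmul_one_smul]
        exact Submodule.smul_mem _ _ hδ }
  have hle : V ≤ leftDiffLT A R R N n := fun δ hδ => hδ.1
  have : IsNoetherian R V := isNoetherian_of_le hle
  obtain ⟨t, ht⟩ := Module.Finite.iff_fg.mp (inferInstance : Module.Finite R V)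
  exact ⟨t, congrArg SetLike.coe ht⟩

end Transfer

theorem isScalarTower_quotAlgebra {A R : Type*} [CommRing A] [IsDomain A] [CommRing R] [Algebra A R]
    (p : Ideal R) [p.IsPrime] (hp : p.comap (algebraMap A R) = ⊥) :
    letI := quotAlgebra p hp
    IsScalarTower A (FractionRing A) (Localization.AtPrime p) :=
  letI := quotAlgebra p hp
  .of_algebraMap_eq fun a => (IsLocalization.lift_eq (M := A⁰) (S := FractionRing A) _ a).symm

end DiffPrimary

theorem theorem3p9 {A : Type*} {R : Type*} [CommRing A] [IsDomain A]
    [IsNoetherianRing A] [CommRing R] [IsNoetherianRing R] [Algebra A R]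
    (hAR : Function.Injective (algebraMap A R))
    (p : Ideal R) [p.IsPrime] (hp : p.comap (algebraMap A R) = ⊥) :
    -- (i)
    (DiffPrimary.ResidueTensorIsNoetherian p hp →
      ∀ I : Ideal R, I.IsPrimary → I.radical = p →
        ∃ E : Submodule (TensorProduct A R R) (R →ₗ[A] p.ResidueField),
          E ≤ DiffPrimary.diffOps A R R p.ResidueField ∧
          (I : Set R) = DiffPrimary.sol (E : Set (R →ₗ[A] p.ResidueField)) ∧
          DiffPrimary.IsFGSubmodule (Localization.AtPrime p)
            (E : Set (R →ₗ[A] p.ResidueField))) ∧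
    -- (ii)
    (Algebra.EssFiniteType A R →
      ∀ (N : Type*) [AddCommGroup N] [Nontrivial N] [Module (R ⧸ p) N] [Module R N] [Module A N]
        [IsScalarTower R (R ⧸ p) N] [IsScalarTower A R N]
        [Module.Finite (R ⧸ p) N] [Module.IsTorsionFree (R ⧸ p) N],
        -- (a)
        (∀ I : Ideal R, I.IsPrimary → I.radical = p →
          ∃ E : Submodule (TensorProduct A R R) (R →ₗ[A] N),
            E ≤ DiffPrimary.diffOps A R R N ∧
            (I : Set R) = DiffPrimary.sol (E : Set (R →ₗ[A] N)) ∧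
            DiffPrimary.IsFGSubmodule R (E : Set (R →ₗ[A] N))) ∧
        -- (b)
        (DiffPrimary.IsSeparableResidueExtension p hp →
          ∀ (n : ℕ) (I : Ideal R), I.IsPrimary → I.radical = p → p ^ (n + 1) ≤ I →
            ∃ E : Submodule (TensorProduct A R R) (R →ₗ[A] N),
              E ≤ DiffPrimary.diffOp A R R N n ∧
              (I : Set R) = DiffPrimary.sol (E : Set (R →ₗ[A] N)))) ∧
    -- the separability hypothesis of (b) holds whenever `Quot(A)` is perfect
    (PerfectField (FractionRing A) → DiffPrimary.IsSeparableResidueExtension p hp) := by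
  let := DiffPrimary.quotAlgebra p hp
  have := DiffPrimary.isScalarTower_quotAlgebra p hp
  refine ⟨fun hT I hI hIp => ?_, fun hA N => ?_, fun hF => ?_⟩
  · have : IsNoetherianRing (p.ResidueField ⊗[FractionRing A] Localization.AtPrime p) := hT
    obtain ⟨n, E, hE, hsol, hfg⟩ :=
      DiffPrimary.exists_sol_eq_of_isNoetherianRing (A := A) p (FractionRing A) I hI hIp
    exact ⟨E, fun δ hδ => ⟨n, hE hδ⟩, hsol, hfg⟩
  · intro _ _ _ _ _ _ _ _ _
    have : Algebra.EssFiniteType (FractionRing A) (Localization.AtPrime p) :=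
      .of_comp A (FractionRing A) (Localization.AtPrime p)
    refine ⟨fun I hI hIp => ?_, fun hsep n I hI hIp hn => ?_⟩
    · have : IsNoetherianRing (p.ResidueField ⊗[FractionRing A] Localization.AtPrime p) :=
        Algebra.EssFiniteType.isNoetherianRing p.ResidueField _
      obtain ⟨n, E, hE, hsol, -⟩ :=
        DiffPrimary.exists_sol_eq_of_isNoetherianRing (A := A) p (FractionRing A) I hI hIp
      have : Module.Finite R N := Module.Finite.trans (R ⧸ p) N
      exact ⟨DiffPrimary.vanishingOps A N (n + 1) I, fun δ hδ => ⟨n, hδ.1⟩,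
        DiffPrimary.sol_vanishingOps N (n + 1) I E hE hsol,
        DiffPrimary.isFGSubmodule_vanishingOps (n + 1) I⟩
    · have : Algebra.IsGeometricallyReduced (FractionRing A) p.ResidueField := hsep
      have : Algebra.EssFiniteType (FractionRing A) p.ResidueField :=
        .of_surjective (IsScalarTower.toAlgHom _ (Localization.AtPrime p) _)
          IsLocalRing.residue_surjective
      have := DiffPrimary.formallySmooth_of_isGeometricallyReduced (FractionRing A) p.ResidueField
      obtain ⟨E, hE, hsol⟩ :=
        DiffPrimary.exists_sol_eq_of_formallySmooth (A := A) p (FractionRing A) I hI hIp (n + 1) hn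
      exact ⟨DiffPrimary.vanishingOps A N (n + 1) I, fun δ hδ => hδ.1,
        DiffPrimary.sol_vanishingOps N (n + 1) I E hE hsol⟩
  · exact DiffPrimary.isGeometricallyReduced_of_perfectField (FractionRing A) p.ResidueField
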